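/- **Conventions.** All matrices are real $m\times m$; $I$ is the identity and $\dfrac{X}{Y}:=Y^{-1}X$ for $Y$ invertible. For sequences of matrices $(a_n)_{n\ge 0}$, $(b_n)_{n\ge 1}$ let $p_{-1}=I,\ p_0=a_0,\ q_{-1}=0,\ q_0=I$ and $p_n=a_np_{n-1}+b_np_{n-2}$, $q_n=a_nq_{n-1}+b_nq_{n-2}$ for $n\ge 1$ ("numerators and denominators of the convergents"). We write $L=\left[a_0;\dfrac{b_n}{a_n}\right]_{n=1}^{+\infty}$ if all $q_n$ are invertible and $q_n^{-1}p_n\to L$. For a positive definite (symmetric) matrix $A$ and real $q$ put $\varphi(A)=\dfrac{I-A}{I+A}$, $\ \ln A=-2\sum_{n\ge 0}\dfrac{1}{2n+1}\varphi(A)^{2n+1}$, $\ A^q=\exp(q\ln A)$. **Theorem 3.1.** Let $A$ be a positive definite real $m\times m$ matrix for which $I-A$ is invertible (i.e. $1$ is not an eigenvalue of $A$), and let $0<q<1$. Then the series defining $\ln A$ converges. Put $A_0=I$, $\widetilde A_0=0$, $$A_1=\frac{-I-q\varphi(A)}{2q\varphi(A)},\qquad \widetilde A_1=(-2\varphi(A))^{-1},$$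 and, for $k\ge 1$ (empty products are $1$), $$A_{2k}=\frac{-2q(q^2-2^2)(q^2-4^2)\cdots(q^2-(2k-2)^2)}{(q^2-1^2)(q^2-3^2)\cdots(q^2-(2k-1)^2)}(4k-1)\,\varphi(A)^{-1},$$ $$A_{2k+1}=\frac{-(q^2-1^2)(q^2-3^2)\cdots(q^2-(2k-1)^2)}{2q(q^2-2^2)(q^2-4^2)\cdots(q^2-(2k)^2)}(4k+1)\,\varphi(A)^{-1},$$ $$\widetilde A_{2k}=\frac{2\,(2\cdot4\cdots(2k-2))^2}{(1\cdot3\cdots(2k-1))^2}(4k-1)\,\varphi(A)^{-1},\qquad \widetilde A_{2k+1}=-\frac{(1\cdot3\cdots(2k-1))^2}{2\,(2\cdot4\cdots(2k))^2}(4k+1)\,\varphi(A)^{-1}.$$ Then $$A^q=\left[I;\frac{I}{A_k}\right]_{k=1}^{+\infty},\qquad \ln A=\left[0;\frac{I}{\widetilde A_k}\right]_{k=1}^{+\infty}.$$ Let $P_n,Q_n$ (resp. $\widetilde P_n,\widetilde Q_n$) be the numerators and denominators of the convergents of these two continued fractions, and for $n\ge 2$ let $$E_n=Q_n\widetilde Q_n\,(Q_{n-2}P_{n-1}+\widetilde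 Q_{n-1}\widetilde P_{n-2}),\qquad F_n=Q_{n-2}\widetilde Q_{n-2}\,(Q_nP_{n-1}+\widetilde Q_{n-1}\widetilde P_n).$$ If $F_n$ is invertible for every $n\ge 2$, then $$A^q\ln A=\left[0;\ \frac{A_1+I}{A_1\widetilde A_1},\ \frac{(A_1A_2+I)(A_1+I)+\widetilde A_1\widetilde A_2}{(A_1A_2+A_2+I)\widetilde A_2},\ \frac{(A_1\widetilde A_1)^{-1}E_2F_3}{E_3-F_3},\ \frac{E_{n-1}F_n}{E_n-F_n}\right]_{n=4}^{+\infty}.$$ The matrices $F_n$, $n\ge 2$, are all invertible whenever $A-I$ is positive definite. -/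

import Mathlib

open scoped Topology

noncomputable section

namespace MatCF

variable {m : ℕ}

/-- The fraction `X / Y = Y⁻¹ X` of two square matrices (meaningful for `Y` invertible). -/
def frac (X Y : Matrix (Fin m) (Fin m) ℝ) : Matrix (Fin m) (Fin m) ℝ := Y⁻¹ * X

/-- `φ(A) = (I - A) / (I + A)`. -/
def phi (A : Matrix (Fin m) (Fin m) ℝ) : Matrix (Fin m) (Fin m) ℝ := frac (1 - A) (1 + A)

/-- The terms of the series of the matrix logarithm. -/
def lnTerm (A : Matrix (Fin m) (Fin m) ℝ) (n : ℕ) : Matrix (Fin m) (Fin m) ℝ :=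
  (1 / (2 * (n : ℝ) + 1)) • phi A ^ (2 * n + 1)

/-- `ln A = -2 ∑ φ(A)^(2n+1) / (2n+1)`. -/
def ln (A : Matrix (Fin m) (Fin m) ℝ) : Matrix (Fin m) (Fin m) ℝ :=
  (-2 : ℝ) • ∑' n : ℕ, lnTerm A n

/-- `A^q = exp (q ln A)`, with the matrix exponential. -/
def pow (A : Matrix (Fin m) (Fin m) ℝ) (q : ℝ) : Matrix (Fin m) (Fin m) ℝ :=
  NormedSpace.exp (q • ln A)

/-- Numerators of the convergents of `[a 0; b 1 / a 1, b 2 / a 2, …]`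
(the value `P_{-1} = I` gives `P_1`; `b 0` is not used). -/
def num (b a : ℕ → Matrix (Fin m) (Fin m) ℝ) : ℕ → Matrix (Fin m) (Fin m) ℝ
  | 0 => a 0
  | 1 => a 1 * a 0 + b 1
  | n + 2 => a (n + 2) * num b a (n + 1) + b (n + 2) * num b a n

/-- Denominators of the convergents of `[a 0; b 1 / a 1, b 2 / a 2, …]`
(the value `Q_{-1} = 0` gives `Q_1`; `b 0` is not used). -/
def den (b a : ℕ → Matrix (Fin m) (Fin m) ℝ) : ℕ → Matrix (Fin m) (Fin m) ℝ
  | 0 => 1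
  | 1 => a 1
  | n + 2 => a (n + 2) * den b a (n + 1) + b (n + 2) * den b a n

/-- `L = [a 0; b n / a n]_{n ≥ 1}`: all the convergents `P_n / Q_n` are defined, and they
converge to `L`. -/
def IsContFrac (b a : ℕ → Matrix (Fin m) (Fin m) ℝ) (L : Matrix (Fin m) (Fin m) ℝ) : Prop :=
  (∀ n, IsUnit (den b a n)) ∧
    Filter.Tendsto (fun n => frac (num b a n) (den b a n)) Filter.atTop (𝓝 L)

/-- The partial numerators of a simple continued fraction. -/
def ones : ℕ → Matrix (Fin m) (Fin m) ℝ := fun _ => 1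

/-- `(q² - 2²)(q² - 4²) ⋯ (q² - (2k)²)`. -/
def evenProd (q : ℝ) (k : ℕ) : ℝ := ∏ j ∈ Finset.Icc 1 k, (q ^ 2 - (2 * (j : ℝ)) ^ 2)

/-- `(q² - 1²)(q² - 3²) ⋯ (q² - (2k-1)²)`. -/
def oddProd (q : ℝ) (k : ℕ) : ℝ := ∏ j ∈ Finset.Icc 1 k, (q ^ 2 - (2 * (j : ℝ) - 1) ^ 2)

/-- `2 · 4 ⋯ (2k)`. -/
def evenFac (k : ℕ) : ℝ := ∏ j ∈ Finset.Icc 1 k, (2 * (j : ℝ))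

/-- `1 · 3 ⋯ (2k-1)`. -/
def oddFac (k : ℕ) : ℝ := ∏ j ∈ Finset.Icc 1 k, (2 * (j : ℝ) - 1)

/-- The coefficients `A_n` of the simple continued fraction of `A^q`
(in both branches `n / 2` is the `k` of `n = 2k` or `n = 2k + 1`, and `k ≥ 1`). -/
def powCoeff (q : ℝ) (A : Matrix (Fin m) (Fin m) ℝ) (n : ℕ) : Matrix (Fin m) (Fin m) ℝ :=
  if n = 0 then 1
  else if n = 1 then frac (-1 - q • phi A) ((2 * q) • phi A)
  else if Even n then
    frac ((-(2 * q * evenProd q (n / 2 - 1)) / oddProd q (n / 2) *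
      (4 * ((n / 2 : ℕ) : ℝ) - 1)) • 1) (phi A)
  else
    frac ((-oddProd q (n / 2) / (2 * q * evenProd q (n / 2)) *
      (4 * ((n / 2 : ℕ) : ℝ) + 1)) • 1) (phi A)

/-- The coefficients `Ã_n` of the simple continued fraction of `ln A`
(in both branches `n / 2` is the `k` of `n = 2k` or `n = 2k + 1`, and `k ≥ 1`). -/
def lnCoeff (A : Matrix (Fin m) (Fin m) ℝ) (n : ℕ) : Matrix (Fin m) (Fin m) ℝ :=
  if n = 0 then 0
  else if n = 1 then ((-2 : ℝ) • phi A)⁻¹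
  else if Even n then
    frac ((2 * evenFac (n / 2 - 1) ^ 2 / oddFac (n / 2) ^ 2 *
      (4 * ((n / 2 : ℕ) : ℝ) - 1)) • 1) (phi A)
  else
    frac ((-oddFac (n / 2) ^ 2 / (2 * evenFac (n / 2) ^ 2) *
      (4 * ((n / 2 : ℕ) : ℝ) + 1)) • 1) (phi A)

/-- `P_n`. -/
def powP (q : ℝ) (A : Matrix (Fin m) (Fin m) ℝ) : ℕ → Matrix (Fin m) (Fin m) ℝ :=
  num ones (powCoeff q A)

/-- `Q_n`. -/
def powQ (q : ℝ) (A : Matrix (Fin m) (Fin m) ℝ) : ℕ → Matrix (Fin m) (Fin m) ℝ :=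
  den ones (powCoeff q A)

/-- `P̃_n`. -/
def lnP (A : Matrix (Fin m) (Fin m) ℝ) : ℕ → Matrix (Fin m) (Fin m) ℝ :=
  num ones (lnCoeff A)

/-- `Q̃_n`. -/
def lnQ (A : Matrix (Fin m) (Fin m) ℝ) : ℕ → Matrix (Fin m) (Fin m) ℝ :=
  den ones (lnCoeff A)

/-- `E_n` (used for `n ≥ 2` only). -/
def E (q : ℝ) (A : Matrix (Fin m) (Fin m) ℝ) (n : ℕ) : Matrix (Fin m) (Fin m) ℝ :=
  powQ q A n * lnQ A n * (powQ q A (n - 2) * powP q A (n - 1) + lnQ A (n - 1) * lnP A (n - 2))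

/-- `F_n` (used for `n ≥ 2` only). -/
def F (q : ℝ) (A : Matrix (Fin m) (Fin m) ℝ) (n : ℕ) : Matrix (Fin m) (Fin m) ℝ :=
  powQ q A (n - 2) * lnQ A (n - 2) * (powQ q A n * powP q A (n - 1) + lnQ A (n - 1) * lnP A n)

/-- The partial numerators of the continued fraction of `A^q ln A` (index `0` is not used). -/
def prodNum (q : ℝ) (A : Matrix (Fin m) (Fin m) ℝ) : ℕ → Matrix (Fin m) (Fin m) ℝ
  | 0 => 1
  | 1 => powCoeff q A 1 + 1
  | 2 => (powCoeff q A 1 * powCoeff q A 2 + 1) * (powCoeff q A 1 + 1) + lnCoeff A 1 * lnCoeff A 2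
  | 3 => (powCoeff q A 1 * lnCoeff A 1)⁻¹ * E q A 2 * F q A 3
  | n + 4 => E q A (n + 3) * F q A (n + 4)

/-- The partial denominators of the continued fraction of `A^q ln A`. -/
def prodDen (q : ℝ) (A : Matrix (Fin m) (Fin m) ℝ) : ℕ → Matrix (Fin m) (Fin m) ℝ
  | 0 => 0
  | 1 => powCoeff q A 1 * lnCoeff A 1
  | 2 => (powCoeff q A 1 * powCoeff q A 2 + powCoeff q A 2 + 1) * lnCoeff A 2
  | n + 3 => E q A (n + 3) - F q A (n + 3)

end MatCF

end

/-!
Everything takes place in the commutative algebra generated by the symmetric matrix `A`. An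
injective algebra homomorphism `Φ` from tuples of reals sends the tuple of eigenvalues to `A`
(`exists_spectral_algHom`), and all the objects in the statement are images under `Φ` of the same
objects formed with each eigenvalue `x > 0`, `x ≠ 1` (`isContFrac_map`). So the problem is scalar,
with `z = (1 - x) / (1 + x)`, `0 < |z| < 1`.

An equivalence transformation (`scale`) turns both simple continued fractions into
`a₀ + βz / (1 + qz + (q² - 1²) z² / (3 + (q² - 2²) z² / (5 + ⋯)))`, with `a₀ = 1`, `β = -2q` for the
power and `a₀ = 0`, `β = -2`, `q = 0` for the logarithm. Its numerators `N n` and denominators `D n`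
satisfy one three-term recurrence (`gaussSeq`), and `D n ≥ (n - q) D (n - 1)`, so that the
denominators are positive (`gaussSeq_growth`). The remainders `L D n - N n` satisfy the same
recurrence. The recurrence has an explicit solution given by hypergeometric power series in `z`
(`minSol`), whose first two terms are, by the binomial and logarithmic series, the first two
remainders up to a common factor (`minSol_eq_rpow`, `minSol_eq_log`). Hence all remainders are
multiples of `minSol`. Its coefficients are at most `∏ (k + q)`, so
`minSol q z n / D n = O(∏ (k + q) / (k - q) * |z| ^ (2 n))`, which tends to zero
(`tendsto_minSol_div`, `tendsto_gaussCoeff`).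

The continued fraction of `A ^ q * ln A` is Euler's continued fraction for the telescoping series of
the products `P n * P' n / (Q n * Q' n)`, because `F n / E n` is minus the ratio of the
`n`-th to the `(n - 1)`-th difference of these products (`cfE_mul_sub`). Its `n`-th denominator is
`E 2 ⋯ E n` (`cfDen_prod_succ`), and `E (n + 1)` and `F n` share a factor by the determinant formula, so that it
is invertible when the `F n` are. If `A - 1` is positive definite then every `z` is negative, and the
two summands in `F n` have the same sign (`cfF_gaussCoeff_ne_zero`).
-/

namespace MatCF

/-! ### The three-term recurrence and the growth of its solutions -/

/-- The solution with initial values `f₀`, `f₁` of the recurrence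
`f (n + 2) = (2 n + 3) f (n + 1) + (q² - (n + 1)²) z² f n`, which is satisfied by the numerators and
the denominators of the fraction-free form
`βz / (1 + qz + (q² - 1²) z² / (3 + (q² - 2²) z² / (5 + ⋯)))` of both continued fractions. -/
def gaussSeq (q z f₀ f₁ : ℝ) : ℕ → ℝ
  | 0 => f₀
  | 1 => f₁
  | n + 2 => (2 * (n : ℝ) + 3) * gaussSeq q z f₀ f₁ (n + 1)
      + (q ^ 2 - ((n : ℝ) + 1) ^ 2) * z ^ 2 * gaussSeq q z f₀ f₁ n

theorem gaussSeq_linear (q z a b f₀ f₁ g₀ g₁ : ℝ) (n : ℕ) :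
    gaussSeq q z (a * f₀ + b * g₀) (a * f₁ + b * g₁) n =
      a * gaussSeq q z f₀ f₁ n + b * gaussSeq q z g₀ g₁ n := by
  induction n using Nat.twoStepInduction with
  | zero => rfl
  | one => rfl
  | more n h₀ h₁ => simp only [gaussSeq, h₀, h₁]; ring

/-- The growth condition `f₁ ≥ (1 - q) f₀` propagates: since `z² < 1` and
`(n + 1)² - q² = (n + 1 - q) (n + 1 + q)`, the ratio bound `n + 1 - q` at one step gives
`2 n + 3 - (n + 1 + q) = n + 2 - q` at the next. -/
theorem gaussSeq_growth {q z f₀ f₁ : ℝ} (hq0 : 0 ≤ q) (hq1 : q < 1) (hz : z ^ 2 < 1)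
    (h₀ : 0 ≤ f₀) (h₁ : 0 < f₁) (h : (1 - q) * f₀ ≤ f₁) (n : ℕ) :
    0 < gaussSeq q z f₀ f₁ (n + 1) ∧ 0 ≤ gaussSeq q z f₀ f₁ n ∧
      ((n : ℝ) + 1 - q) * gaussSeq q z f₀ f₁ n ≤ gaussSeq q z f₀ f₁ (n + 1) := by
  induction n with
  | zero => simpa [gaussSeq] using ⟨h₁, h₀, h⟩
  | succ n ih =>
    obtain ⟨i1, i0, i⟩ := ih
    have hn : (0 : ℝ) ≤ n := n.cast_nonneg
    have key : ((n : ℝ) + 2 - q) * gaussSeq q z f₀ f₁ (n + 1) ≤ gaussSeq q z f₀ f₁ (n + 2) := by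
      have e1 : ((n : ℝ) + 1 - q) * ((n : ℝ) + 1 + q) * z ^ 2 * gaussSeq q z f₀ f₁ n ≤
          ((n : ℝ) + 1 - q) * ((n : ℝ) + 1 + q) * 1 * gaussSeq q z f₀ f₁ n := by
        have : 0 ≤ ((n : ℝ) + 1 - q) * ((n : ℝ) + 1 + q) :=
          mul_nonneg (by linarith) (by linarith)
        gcongr
      have e2 := mul_le_mul_of_nonneg_left i (by linarith : (0 : ℝ) ≤ n + 1 + q)
      simp only [gaussSeq]
      nlinarith
    refine ⟨lt_of_lt_of_le (mul_pos (by linarith) i1) key, i1.le, ?_⟩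
    push_cast
    convert key using 2
    ring

theorem gaussSeq_ge_prod {q z f₁ : ℝ} (hq0 : 0 ≤ q) (hq1 : q < 1) (hz : z ^ 2 < 1)
    (h : 1 - q ≤ f₁) (n : ℕ) :
    ∏ k ∈ Finset.range n, ((k : ℝ) + 1 - q) ≤ gaussSeq q z 1 f₁ n := by
  induction n with
  | zero => simp [gaussSeq]
  | succ n ih =>
    have hn : (0 : ℝ) ≤ n := n.cast_nonneg
    rw [Finset.prod_range_succ, mul_comm]
    exact (mul_le_mul_of_nonneg_left ih (by linarith)).trans
      (gaussSeq_growth hq0 hq1 hz zero_le_one (by linarith) (by linarith) n).2.2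

/-! ### The minimal solution of the recurrence, as a power series -/

/-- The coefficient of `z ^ (2 n + 1 + 2 j)` in the `n`-th term of the minimal solution of the
recurrence. For fixed `n` this is, up to a constant factor, the hypergeometric coefficient
`((n + 1 - q) / 2)_j ((n + 2 - q) / 2)_j / ((n + 3 / 2)_j j!)`. -/
noncomputable def minCoeff (q : ℝ) : ℕ → ℕ → ℝ
  | 0, 0 => 1
  | 0, j + 1 => minCoeff q 0 j * ((2 * j + 1 - q) * (2 * j + 2 - q)) /
      ((2 * j + 2) * (2 * j + 3))
  | n + 1, j => minCoeff q n j * ((n + 1 + q) * (n + 1 + 2 * j - q)) / (2 * n + 3 + 2 * j)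

theorem minCoeff_succ_right (q : ℝ) (n j : ℕ) :
    minCoeff q n (j + 1) = minCoeff q n j * ((n + 1 + 2 * j - q) * (n + 2 + 2 * j - q)) /
      ((2 * j + 2) * (2 * n + 3 + 2 * j)) := by
  induction n with
  | zero =>
    simp only [minCoeff]
    push_cast
    congr 1 <;> ring
  | succ n ih =>
    simp only [minCoeff, ih]
    push_cast
    have h1 : (2 * (n : ℝ) + 3 + 2 * (j + 1)) ≠ 0 := by positivity
    have h2 : (2 * (n : ℝ) + 3 + 2 * j) ≠ 0 := by positivity
    have h3 : (2 * (j : ℝ) + 2) ≠ 0 := by positivity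
    have h4 : (2 * ((n : ℝ) + 1) + 3 + 2 * j) ≠ 0 := by positivity
    field_simp
    ring

theorem minCoeff_three_term (q : ℝ) (n j : ℕ) :
    minCoeff q (n + 2) j = (2 * n + 3) * minCoeff q (n + 1) (j + 1) +
      (q ^ 2 - (n + 1) ^ 2) * minCoeff q n (j + 1) := by
  simp only [minCoeff, minCoeff_succ_right]
  push_cast
  have h1 : (2 * (n : ℝ) + 3 + 2 * (j + 1)) ≠ 0 := by positivity
  have h2 : (2 * (n : ℝ) + 3 + 2 * j) ≠ 0 := by positivity
  have h3 : (2 * (j : ℝ) + 2) ≠ 0 := by positivity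
  have h4 : (2 * ((n : ℝ) + 1) + 3 + 2 * j) ≠ 0 := by positivity
  field_simp
  ring

theorem minCoeff_three_term_zero (q : ℝ) (n : ℕ) :
    (2 * n + 3) * minCoeff q (n + 1) 0 + (q ^ 2 - (n + 1) ^ 2) * minCoeff q n 0 = 0 := by
  simp only [minCoeff]
  have h2 : (2 * (n : ℝ) + 3) ≠ 0 := by positivity
  push_cast
  field_simp
  ring

theorem minCoeff_bounds {q : ℝ} (hq0 : 0 ≤ q) (hq1 : q < 1) (n j : ℕ) :
    0 ≤ minCoeff q n j ∧ minCoeff q n j ≤ ∏ k ∈ Finset.range n, ((k : ℝ) + 1 + q) := by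
  induction n with
  | zero =>
    induction j with
    | zero => simp [minCoeff]
    | succ j ih =>
      have hj : (0 : ℝ) ≤ j := j.cast_nonneg
      have h1 : 0 ≤ (2 * (j : ℝ) + 1 - q) * (2 * j + 2 - q) :=
        mul_nonneg (by linarith) (by linarith)
      simp only [minCoeff, Finset.range_zero, Finset.prod_empty] at ih ⊢
      refine ⟨div_nonneg (mul_nonneg ih.1 h1) (by positivity), ?_⟩
      rw [div_le_one (by positivity)]
      have h2 : (2 * (j : ℝ) + 1 - q) * (2 * j + 2 - q) ≤ (2 * j + 2) * (2 * j + 3) :=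
        mul_le_mul (by linarith) (by linarith) (by linarith) (by linarith)
      nlinarith [mul_le_mul_of_nonneg_right ih.2 h1]
  | succ n ih =>
    have hj : (0 : ℝ) ≤ j := j.cast_nonneg
    have hn : (0 : ℝ) ≤ n := n.cast_nonneg
    have h1 : 0 ≤ (n : ℝ) + 1 + 2 * j - q := by linarith
    have hP : 0 ≤ minCoeff q n j * (n + 1 + q) := mul_nonneg ih.1 (by linarith)
    simp only [minCoeff]
    refine ⟨div_nonneg (mul_nonneg ih.1 (mul_nonneg (by linarith) h1)) (by positivity), ?_⟩
    rw [Finset.prod_range_succ, div_le_iff₀ (by positivity), ← mul_assoc]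
    exact mul_le_mul (mul_le_mul_of_nonneg_right ih.2 (by linarith)) (by linarith) h1
      (mul_nonneg (ih.1.trans ih.2) (by linarith))

/-- The minimal solution `z ^ (2 n + 1) ∑ j, minCoeff q n j z ^ (2 j)` of the recurrence. -/
noncomputable def minSol (q z : ℝ) (n : ℕ) : ℝ := ∑' j, minCoeff q n j * z ^ (2 * n + 1 + 2 * j)

theorem summable_minSol {q z : ℝ} (hq0 : 0 ≤ q) (hq1 : q < 1) (hz : z ^ 2 < 1) (n : ℕ) :
    Summable fun j => minCoeff q n j * z ^ (2 * n + 1 + 2 * j) := by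
  refine Summable.of_norm_bounded (g := fun j =>
    (∏ k ∈ Finset.range n, ((k : ℝ) + 1 + q)) * |z| ^ (2 * n + 1) * (z ^ 2) ^ j)
    ((summable_geometric_of_lt_one (sq_nonneg z) hz).mul_left _) fun j => ?_
  obtain ⟨h1, h2⟩ := minCoeff_bounds hq0 hq1 n j
  rw [norm_mul, Real.norm_of_nonneg h1, norm_pow, Real.norm_eq_abs, pow_add, pow_mul |z| 2 j,
    sq_abs, mul_assoc]
  gcongr

theorem abs_minSol_le {q z : ℝ} (hq0 : 0 ≤ q) (hq1 : q < 1) (hz : z ^ 2 < 1) (n : ℕ) :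
    |minSol q z n| ≤
      (∏ k ∈ Finset.range n, ((k : ℝ) + 1 + q)) * |z| ^ (2 * n + 1) * (1 - z ^ 2)⁻¹ := by
  rw [← Real.norm_eq_abs]
  refine tsum_of_norm_bounded ((hasSum_geometric_of_lt_one (sq_nonneg z) hz).mul_left _)
    fun j => ?_
  obtain ⟨h1, h2⟩ := minCoeff_bounds hq0 hq1 n j
  rw [norm_mul, Real.norm_of_nonneg h1, norm_pow, Real.norm_eq_abs, pow_add, pow_mul |z| 2 j,
    sq_abs, mul_assoc]
  gcongr

theorem minSol_three_term {q z : ℝ} (hq0 : 0 ≤ q) (hq1 : q < 1) (hz : z ^ 2 < 1) (n : ℕ) :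
    minSol q z (n + 2) = (2 * (n : ℝ) + 3) * minSol q z (n + 1) +
      (q ^ 2 - ((n : ℝ) + 1) ^ 2) * z ^ 2 * minSol q z n := by
  have s1 := summable_minSol hq0 hq1 hz (n + 1)
  have s0 := summable_minSol hq0 hq1 hz n
  unfold minSol
  rw [s1.tsum_eq_zero_add, s0.tsum_eq_zero_add, mul_add (_ + _) _ (tsum _),
    ← tsum_mul_left, mul_add (_ * z ^ 2), ← tsum_mul_left, add_add_add_comm,
    ← (((summable_nat_add_iff 1).2 s1).mul_left _).tsum_add
      (((summable_nat_add_iff 1).2 s0).mul_left _)]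
  have h0 : (2 * (n : ℝ) + 3) * (minCoeff q (n + 1) 0 * z ^ (2 * (n + 1) + 1 + 2 * 0)) +
      (q ^ 2 - ((n : ℝ) + 1) ^ 2) * z ^ 2 * (minCoeff q n 0 * z ^ (2 * n + 1 + 2 * 0)) = 0 := by
    linear_combination z ^ (2 * n + 3) * minCoeff_three_term_zero q n
  rw [h0, zero_add]
  refine tsum_congr fun j => ?_
  rw [minCoeff_three_term]
  ring

theorem gaussSeq_minSol {q z : ℝ} (hq0 : 0 ≤ q) (hq1 : q < 1) (hz : z ^ 2 < 1) (n : ℕ) :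
    gaussSeq q z (minSol q z 0) (minSol q z 1) n = minSol q z n := by
  induction n using Nat.twoStepInduction with
  | zero => rfl
  | one => rfl
  | more n h₀ h₁ => rw [gaussSeq, h₀, h₁, minSol_three_term hq0 hq1 hz]

/-- The minimal solution is negligible against every solution of the growth of
`gaussSeq_growth`: the quotient is at most a constant times
`∏ (k + q) / (k - q) * |z| ^ (2 n)`, whose ratios tend to `z² < 1`. -/
theorem tendsto_minSol_div {q z f₁ : ℝ} (hq0 : 0 ≤ q) (hq1 : q < 1) (hz0 : z ≠ 0)
    (hz : z ^ 2 < 1) (h : 1 - q ≤ f₁) :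
    Filter.Tendsto (fun n => minSol q z n / gaussSeq q z 1 f₁ n) Filter.atTop (𝓝 0) := by
  set u : ℕ → ℝ := fun n =>
    (∏ k ∈ Finset.range n, (((k : ℝ) + 1 + q) / ((k : ℝ) + 1 - q))) * |z| ^ (2 * n + 1) with hu
  have pos1 (k : ℕ) : (0 : ℝ) < k + 1 + q := by positivity
  have pos2 (k : ℕ) : (0 : ℝ) < k + 1 - q := by
    have : (0 : ℝ) ≤ k := k.cast_nonneg
    linarith
  have hupos (n : ℕ) : 0 < u n :=
    mul_pos (Finset.prod_pos fun k _ => div_pos (pos1 k) (pos2 k)) (pow_pos (abs_pos.2 hz0) _)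
  have hratio (n : ℕ) : ‖u (n + 1)‖ / ‖u n‖ = (1 + 2 * q / ((n : ℝ) + (1 - q))) * z ^ 2 := by
    have h1 : u (n + 1) = u n * ((1 + 2 * q / ((n : ℝ) + (1 - q))) * z ^ 2) := by
      have e : ((n : ℝ) + 1 + q) / ((n : ℝ) + 1 - q) = 1 + 2 * q / ((n : ℝ) + (1 - q)) := by
        have := (pos2 n).ne'
        have h' : (n : ℝ) + (1 - q) ≠ 0 := by convert this using 1; ring
        field_simp
        ring
      simp only [hu, Finset.prod_range_succ, e]
      rw [← sq_abs z]
      ring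
    rw [Real.norm_of_nonneg (hupos _).le, Real.norm_of_nonneg (hupos _).le, h1,
      mul_div_cancel_left₀ _ (hupos n).ne']
  have hsum : Summable u := by
    refine summable_of_ratio_test_tendsto_lt_one hz
      (Filter.Eventually.of_forall fun n => (hupos n).ne') ?_
    simp only [hratio]
    have : Filter.Tendsto (fun n : ℕ => 2 * q / ((n : ℝ) + (1 - q))) Filter.atTop (𝓝 0) :=
      (Filter.tendsto_atTop_add_const_right _ _ tendsto_natCast_atTop_atTop).const_div_atTop _
    simpa using (this.const_add 1).mul_const (z ^ 2)
  have hlim : Filter.Tendsto (fun n => u n * (1 - z ^ 2)⁻¹) Filter.atTop (𝓝 0) := by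
    simpa using hsum.tendsto_atTop_zero.mul_const (1 - z ^ 2)⁻¹
  refine squeeze_zero_norm (fun n => ?_) hlim
  have hP : 0 < ∏ k ∈ Finset.range n, ((k : ℝ) + 1 - q) := Finset.prod_pos fun k _ => pos2 k
  have hD := gaussSeq_ge_prod hq0 hq1 hz h n
  rw [norm_div, Real.norm_eq_abs, Real.norm_of_nonneg (hP.le.trans hD)]
  simp only [hu, Finset.prod_div_distrib]
  calc |minSol q z n| / gaussSeq q z 1 f₁ n
      ≤ ((∏ k ∈ Finset.range n, ((k : ℝ) + 1 + q)) * |z| ^ (2 * n + 1) * (1 - z ^ 2)⁻¹) /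
          ∏ k ∈ Finset.range n, ((k : ℝ) + 1 - q) := by
        have := abs_minSol_le hq0 hq1 hz n
        exact div_le_div₀ ((abs_nonneg _).trans this) this hP hD
    _ = _ := by ring

/-! ### The initial values of the minimal solution -/

theorem choose_succ_mul (q : ℝ) (n : ℕ) :
    Ring.choose q (n + 1) * (n + 1) = Ring.choose q n * (q - n) := by
  have h1 := Ring.descPochhammer_eq_factorial_smul_choose q (n + 1)
  have h0 := Ring.descPochhammer_eq_factorial_smul_choose q n
  have hf : (n.factorial : ℝ) ≠ 0 := by positivity
  rw [descPochhammer_succ_right, Polynomial.smeval_mul, h0] at h1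
  simp [Polynomial.smeval_sub, Polynomial.smeval_X, Polynomial.smeval_natCast,
    Nat.factorial_succ] at h1
  apply mul_left_cancel₀ hf
  linear_combination -h1

theorem choose_two_mul_add_one (q : ℝ) (j : ℕ) :
    Ring.choose q (2 * j + 1) = q * minCoeff q 0 j := by
  induction j with
  | zero => simp [minCoeff]
  | succ j ih =>
    have h1 := choose_succ_mul q (2 * j + 1)
    have h2 := choose_succ_mul q (2 * j + 2)
    push_cast at h1 h2
    rw [ih] at h1
    have e : 2 * (j + 1) + 1 = 2 * j + 2 + 1 := by ring
    rw [e, minCoeff]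
    have h3 : (2 * (j : ℝ) + 2) ≠ 0 := by positivity
    have h4 : (2 * (j : ℝ) + 3) ≠ 0 := by positivity
    field_simp
    linear_combination (2 * (j : ℝ) + 2) * h2 + (q - (2 * j + 2)) * h1

theorem choose_two_mul_add_two (q : ℝ) (j : ℕ) :
    Ring.choose q (2 * j + 3) - q * Ring.choose q (2 * j + 2) = q * minCoeff q 1 j := by
  have h1 := choose_succ_mul q (2 * j + 1)
  have h2 := choose_succ_mul q (2 * j + 2)
  push_cast at h1 h2
  rw [choose_two_mul_add_one] at h1
  simp only [minCoeff]
  push_cast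
  have h3 : (2 * (j : ℝ) + 2) ≠ 0 := by positivity
  have h4 : (2 * (j : ℝ) + 3) ≠ 0 := by positivity
  have h5 : (2 * (0 : ℝ) + 3 + 2 * j) ≠ 0 := by positivity
  have e1 : Ring.choose q (2 * j + 2) = q * minCoeff q 0 j * (q - (2 * j + 1)) / (2 * j + 2) := by
    field_simp
    linear_combination h1
  have e2 : Ring.choose q (2 * j + 3) = Ring.choose q (2 * j + 2) * (q - (2 * j + 2)) /
      (2 * j + 3) := by
    field_simp
    linear_combination h2
  rw [e2, e1]
  field_simp
  ring

theorem hasSum_one_add_rpow {q z : ℝ} (hz : |z| < 1) :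
    HasSum (fun n => Ring.choose q n * z ^ n) ((1 + z) ^ q) := by
  have := (Real.one_add_rpow_hasFPowerSeriesOnBall_zero (a := q)).hasSum (y := z)
    (by simpa [enorm_eq_nnnorm, ← NNReal.coe_lt_coe] using hz)
  simpa [binomialSeries, FormalMultilinearSeries.coeff_ofScalars, mul_comm] using this

/-- The first two terms of the minimal solution are the odd parts of `(1 + z) ^ q / q` and
`(1 - q z) (1 + z) ^ q / q`. -/
theorem minSol_eq_rpow {q z : ℝ} (hq0 : 0 < q) (hq1 : q < 1) (hz : |z| < 1) :
    2 * q * minSol q z 0 = (1 + z) ^ q - (1 - z) ^ q ∧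
      2 * q * minSol q z 1 = (1 - q * z) * (1 + z) ^ q - (1 + q * z) * (1 - z) ^ q := by
  have hz2 : z ^ 2 < 1 := (sq_lt_one_iff_abs_lt_one z).2 hz
  have hp := hasSum_one_add_rpow (q := q) hz
  have hm := hasSum_one_add_rpow (q := q) (z := -z) (by rwa [abs_neg])
  rw [← sub_eq_add_neg] at hm
  have inj1 : Function.Injective fun j : ℕ => 2 * j + 1 := fun a b h => by simpa using h
  have inj0 : Function.Injective fun j : ℕ => 2 * j := fun a b h => by simpa using h
  have odd_part : HasSum (fun j => 2 * (Ring.choose q (2 * j + 1) * z ^ (2 * j + 1)))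
      ((1 + z) ^ q - (1 - z) ^ q) := by
    have := (inj1.hasSum_iff (fun n hn => ?_)).2 (hp.sub hm)
    · convert! this using 1
      funext j
      simp only [Function.comp_apply, (odd_two_mul_add_one j).neg_pow]
      ring
    · have : Even n := by
        rw [← Nat.not_odd_iff_even]
        rintro ⟨k, rfl⟩
        exact hn ⟨k, rfl⟩
      simp [this.neg_pow]
  have even_part : HasSum (fun j => 2 * (Ring.choose q (2 * j) * z ^ (2 * j)))
      ((1 + z) ^ q + (1 - z) ^ q) := by
    have := (inj0.hasSum_iff (fun n hn => ?_)).2 (hp.add hm)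
    · convert! this using 1
      funext j
      simp only [Function.comp_apply, (even_two_mul j).neg_pow]
      ring
    · have : Odd n := by
        rw [← Nat.not_even_iff_odd]
        rintro ⟨k, rfl⟩
        exact hn ⟨k, by simp; ring⟩
      simp [this.neg_pow]
  constructor
  · have h := (summable_minSol hq0.le hq1 hz2 0).hasSum.mul_left (2 * q)
    refine h.unique ?_
    convert! odd_part using 1
    funext j
    rw [choose_two_mul_add_one]
    ring
  · have h := (summable_minSol hq0.le hq1 hz2 1).hasSum.mul_left (2 * q)
    refine h.unique ?_
    have h2 := (hasSum_nat_add_iff' 1).2 (odd_part.sub (even_part.mul_left (q * z)))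
    convert! h2 using 1
    · funext j
      have := choose_two_mul_add_two q j
      rw [show 2 * (j + 1) + 1 = 2 * j + 3 by ring, show 2 * (j + 1) = 2 * j + 2 by ring]
      linear_combination -(2 * z ^ (2 * j + 3)) * this
    · simp
      ring

theorem minCoeff_zero_zero (j : ℕ) : minCoeff 0 0 j = 1 / (2 * j + 1) := by
  induction j with
  | zero => simp [minCoeff]
  | succ j ih =>
    rw [minCoeff, ih]
    push_cast
    field_simp
    ring

theorem hasSum_log_term {z : ℝ} (hz : |z| < 1) :
    HasSum (fun j : ℕ => 1 / (2 * (j : ℝ) + 1) * z ^ (2 * j + 1))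
      ((Real.log (1 + z) - Real.log (1 - z)) / 2) := by
  convert! (Real.hasSum_log_sub_log_of_abs_lt_one hz).div_const 2 using 1
  funext j
  ring

theorem minSol_eq_log {z : ℝ} (hz : |z| < 1) :
    2 * minSol 0 z 0 = Real.log (1 + z) - Real.log (1 - z) ∧
      2 * minSol 0 z 1 = Real.log (1 + z) - Real.log (1 - z) - 2 * z := by
  have hl := hasSum_log_term hz
  constructor
  · have : minSol 0 z 0 = (Real.log (1 + z) - Real.log (1 - z)) / 2 := by
      rw [← hl.tsum_eq]
      refine tsum_congr fun j => ?_
      rw [minCoeff_zero_zero]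
      ring
    rw [this]
    ring
  · have : minSol 0 z 1 = (Real.log (1 + z) - Real.log (1 - z)) / 2 - z := by
      have h2 := (hasSum_nat_add_iff' 1).2 hl
      simp only [Finset.sum_range_one, Nat.cast_zero, mul_zero, zero_add, div_one, one_mul,
        pow_one] at h2
      rw [← h2.tsum_eq]
      refine tsum_congr fun j => ?_
      rw [minCoeff, minCoeff_zero_zero]
      push_cast
      field_simp
      ring
    rw [this]
    ring

/-! ### Continued fractions over a ring -/

section Ring

variable {R S : Type*} [Ring R] [Ring S]

/-- Numerators of the convergents of `[a 0; b 1 / a 1, b 2 / a 2, …]` over a ring. -/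
def cfNum (b a : ℕ → R) : ℕ → R
  | 0 => a 0
  | 1 => a 1 * a 0 + b 1
  | n + 2 => a (n + 2) * cfNum b a (n + 1) + b (n + 2) * cfNum b a n

/-- Denominators of the convergents of `[a 0; b 1 / a 1, b 2 / a 2, …]` over a ring. -/
def cfDen (b a : ℕ → R) : ℕ → R
  | 0 => 1
  | 1 => a 1
  | n + 2 => a (n + 2) * cfDen b a (n + 1) + b (n + 2) * cfDen b a n

theorem map_cfNum (f : R →+* S) (b a : ℕ → R) (n : ℕ) :
    f (cfNum b a n) = cfNum (fun k => f (b k)) (fun k => f (a k)) n := by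
  induction n using Nat.twoStepInduction with
  | zero => rfl
  | one => simp [cfNum]
  | more n h₀ h₁ => simp [cfNum, h₀, h₁]

theorem map_cfDen (f : R →+* S) (b a : ℕ → R) (n : ℕ) :
    f (cfDen b a n) = cfDen (fun k => f (b k)) (fun k => f (a k)) n := by
  induction n using Nat.twoStepInduction with
  | zero => simp [cfDen]
  | one => simp [cfDen]
  | more n h₀ h₁ => simp [cfDen, h₀, h₁]

/-- The expression `E n` formed with the simple continued fractions of coefficients `a`, `a'`. -/
def cfE (a a' : ℕ → R) (n : ℕ) : R :=
  cfDen 1 a n * cfDen 1 a' n *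
    (cfDen 1 a (n - 2) * cfNum 1 a (n - 1) + cfDen 1 a' (n - 1) * cfNum 1 a' (n - 2))

/-- The expression `F n` formed with the simple continued fractions of coefficients `a`, `a'`. -/
def cfF (a a' : ℕ → R) (n : ℕ) : R :=
  cfDen 1 a (n - 2) * cfDen 1 a' (n - 2) *
    (cfDen 1 a n * cfNum 1 a (n - 1) + cfDen 1 a' (n - 1) * cfNum 1 a' n)

/-- The partial numerators of the product of two simple continued fractions; `i` stands for the
inverse of `a 1 * a' 1`. -/
def cfProdNum (a a' : ℕ → R) (i : R) : ℕ → R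
  | 0 => 1
  | 1 => a 1 + 1
  | 2 => (a 1 * a 2 + 1) * (a 1 + 1) + a' 1 * a' 2
  | 3 => i * cfE a a' 2 * cfF a a' 3
  | n + 4 => cfE a a' (n + 3) * cfF a a' (n + 4)

/-- The partial denominators of the product of two simple continued fractions. -/
def cfProdDen (a a' : ℕ → R) : ℕ → R
  | 0 => 0
  | 1 => a 1 * a' 1
  | 2 => (a 1 * a 2 + a 2 + 1) * a' 2
  | n + 3 => cfE a a' (n + 3) - cfF a a' (n + 3)

theorem map_one_seq (f : R →+* S) : (fun k => f ((1 : ℕ → R) k)) = 1 :=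
  funext fun _ => map_one f

theorem map_cfE (f : R →+* S) (a a' : ℕ → R) (n : ℕ) :
    f (cfE a a' n) = cfE (fun k => f (a k)) (fun k => f (a' k)) n := by
  simp only [cfE, map_mul, map_add, map_cfNum, map_cfDen, map_one_seq]

theorem map_cfF (f : R →+* S) (a a' : ℕ → R) (n : ℕ) :
    f (cfF a a' n) = cfF (fun k => f (a k)) (fun k => f (a' k)) n := by
  simp only [cfF, map_mul, map_add, map_cfNum, map_cfDen, map_one_seq]

theorem map_cfProdNum (f : R →+* S) (a a' : ℕ → R) (i : R) (n : ℕ) :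
    f (cfProdNum a a' i n) = cfProdNum (fun k => f (a k)) (fun k => f (a' k)) (f i) n := by
  match n with
  | 0 | 1 | 2 | 3 | n + 4 => simp [cfProdNum, map_cfE, map_cfF]

theorem map_cfProdDen (f : R →+* S) (a a' : ℕ → R) (n : ℕ) :
    f (cfProdDen a a' n) = cfProdDen (fun k => f (a k)) (fun k => f (a' k)) n := by
  match n with
  | 0 | 1 | 2 | n + 3 => simp [cfProdDen, map_cfE, map_cfF]

end Ring

/-! ### The product of two simple continued fractions -/

section Product

variable {K : Type*} [Field K] {a a' : ℕ → K}

theorem cfNum_mul_cfDen_sub (a : ℕ → K) (n : ℕ) :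
    cfNum 1 a (n + 1) * cfDen 1 a n - cfNum 1 a n * cfDen 1 a (n + 1) = (-1) ^ n := by
  induction n with
  | zero => simp [cfNum, cfDen]; ring
  | succ n ih =>
    simp only [cfNum, cfDen, Pi.one_apply, pow_succ, ← ih]
    ring

/-- The middle factors of `E (n + 1)` and of `F n` agree, by the determinant formula for both
continued fractions. -/
theorem cfE_factor_eq (a a' : ℕ → K) (n : ℕ) :
    cfDen 1 a n * cfNum 1 a (n + 1) + cfDen 1 a' (n + 1) * cfNum 1 a' n =
      cfDen 1 a (n + 1) * cfNum 1 a n + cfDen 1 a' n * cfNum 1 a' (n + 1) := by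
  linear_combination cfNum_mul_cfDen_sub a n - cfNum_mul_cfDen_sub a' n

theorem cfE_ne_zero (h0 : a 0 = 1) (h0' : a' 0 = 0) (h1 : a 1 + 1 ≠ 0)
    (hQ : ∀ n, cfDen 1 a n ≠ 0) (hQ' : ∀ n, cfDen 1 a' n ≠ 0)
    (hF : ∀ n, 2 ≤ n → cfF a a' n ≠ 0) (n : ℕ) : cfE a a' (n + 2) ≠ 0 := by
  refine mul_ne_zero (mul_ne_zero (hQ _) (hQ' _)) ?_
  simp only [Nat.add_sub_cancel, show n + 2 - 1 = n + 1 by omega]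
  cases n with
  | zero => simpa [cfNum, cfDen, h0, h0'] using h1
  | succ n =>
    rw [cfE_factor_eq]
    have := right_ne_zero_of_mul (hF (n + 2) (by omega))
    simpa only [show n + 2 - 1 = n + 1 by omega] using this

/-- `F n / E n` is minus the ratio of the `n`-th to the `(n - 1)`-th difference of the sequence of
products of convergents. -/
theorem cfE_mul_sub (hQ : ∀ n, cfDen 1 a n ≠ 0) (hQ' : ∀ n, cfDen 1 a' n ≠ 0) (n : ℕ) :
    cfE a a' (n + 2) *
        (cfNum 1 a (n + 2) / cfDen 1 a (n + 2) * (cfNum 1 a' (n + 2) / cfDen 1 a' (n + 2)) -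
          cfNum 1 a (n + 1) / cfDen 1 a (n + 1) * (cfNum 1 a' (n + 1) / cfDen 1 a' (n + 1))) =
      -cfF a a' (n + 2) *
        (cfNum 1 a (n + 1) / cfDen 1 a (n + 1) * (cfNum 1 a' (n + 1) / cfDen 1 a' (n + 1)) -
          cfNum 1 a n / cfDen 1 a n * (cfNum 1 a' n / cfDen 1 a' n)) := by
  have step (k : ℕ) : cfNum 1 a (k + 1) / cfDen 1 a (k + 1) *
        (cfNum 1 a' (k + 1) / cfDen 1 a' (k + 1)) -
      cfNum 1 a k / cfDen 1 a k * (cfNum 1 a' k / cfDen 1 a' k) =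
      (-1) ^ k * (cfDen 1 a (k + 1) * cfNum 1 a k + cfDen 1 a' k * cfNum 1 a' (k + 1)) /
        (cfDen 1 a (k + 1) * cfDen 1 a k * cfDen 1 a' (k + 1) * cfDen 1 a' k) := by
    have q0 := hQ k
    have q1 := hQ (k + 1)
    have q0' := hQ' k
    have q1' := hQ' (k + 1)
    rw [div_mul_div_comm, div_mul_div_comm, div_sub_div _ _ (mul_ne_zero q1 q1')
      (mul_ne_zero q0 q0'), div_eq_div_iff (by positivity) (by positivity)]
    have e := cfNum_mul_cfDen_sub a k
    have e' := cfNum_mul_cfDen_sub a' k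
    linear_combination (cfDen 1 a (k + 1) * cfDen 1 a k * cfDen 1 a' (k + 1) * cfDen 1 a' k) *
      (cfNum 1 a' (k + 1) * cfDen 1 a' k * e + cfNum 1 a k * cfDen 1 a (k + 1) * e')
  rw [step (n + 1), step n, cfE, cfF]
  simp only [Nat.add_sub_cancel, show n + 2 - 1 = n + 1 by omega]
  rw [cfE_factor_eq]
  have q0 := hQ n
  have q1 := hQ (n + 1)
  have q2 := hQ (n + 2)
  have q0' := hQ' n
  have q1' := hQ' (n + 1)
  have q2' := hQ' (n + 2)
  rw [show n + 1 + 1 = n + 2 by rfl]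
  field_simp
  ring

theorem cfDen_prod_two (h0 : a 0 = 1) (h0' : a' 0 = 0) (i : K) :
    cfDen (cfProdNum a a' i) (cfProdDen a a') 2 = cfE a a' 2 := by
  simp [cfDen, cfProdNum, cfProdDen, cfE, cfNum, h0, h0']
  ring

/-- The `n`-th denominator of the product continued fraction is `E 2 ⋯ E n`. -/
theorem cfDen_prod_succ (h0 : a 0 = 1) (h0' : a' 0 = 0) (h1 : a 1 ≠ 0) (h1' : a' 1 ≠ 0) (n : ℕ) :
    cfDen (cfProdNum a a' (a 1 * a' 1)⁻¹) (cfProdDen a a') (n + 3) =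
      cfE a a' (n + 3) * cfDen (cfProdNum a a' (a 1 * a' 1)⁻¹) (cfProdDen a a') (n + 2) := by
  have e2 := cfDen_prod_two h0 h0' (a 1 * a' 1)⁻¹
  induction n with
  | zero =>
    rw [cfDen, e2, cfProdNum, cfProdDen, cfDen, cfProdDen]
    field_simp
    ring
  | succ n ih =>
    rw [cfDen, ih, cfProdNum, cfProdDen]
    ring

theorem cfDen_prod_ne_zero (h0 : a 0 = 1) (h0' : a' 0 = 0) (h1 : a 1 ≠ 0) (h1' : a' 1 ≠ 0)
    (hE : ∀ n, cfE a a' (n + 2) ≠ 0) :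
    ∀ n, cfDen (cfProdNum a a' (a 1 * a' 1)⁻¹) (cfProdDen a a') n ≠ 0
  | 0 => by simp [cfDen]
  | 1 => by simp [cfDen, cfProdDen, h1, h1']
  | 2 => by
    rw [cfDen_prod_two h0 h0']
    exact hE 0
  | n + 3 => by
    rw [cfDen_prod_succ h0 h0' h1 h1']
    exact mul_ne_zero (hE _) (cfDen_prod_ne_zero h0 h0' h1 h1' hE (n + 2))

/-- The convergents of the product continued fraction are the products of the convergents of the
two factors. -/
theorem cfNum_prod (h0 : a 0 = 1) (h0' : a' 0 = 0) (h1 : a 1 ≠ 0) (h1' : a' 1 ≠ 0)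
    (hQ : ∀ n, cfDen 1 a n ≠ 0) (hQ' : ∀ n, cfDen 1 a' n ≠ 0) (n : ℕ) :
    cfNum (cfProdNum a a' (a 1 * a' 1)⁻¹) (cfProdDen a a') n =
      cfNum 1 a n / cfDen 1 a n * (cfNum 1 a' n / cfDen 1 a' n) *
        cfDen (cfProdNum a a' (a 1 * a' 1)⁻¹) (cfProdDen a a') n := by
  have c1 : cfNum (cfProdNum a a' (a 1 * a' 1)⁻¹) (cfProdDen a a') 1 =
      cfNum 1 a 1 / cfDen 1 a 1 * (cfNum 1 a' 1 / cfDen 1 a' 1) *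
        cfDen (cfProdNum a a' (a 1 * a' 1)⁻¹) (cfProdDen a a') 1 := by
    simp [cfDen, cfNum, cfProdNum, cfProdDen, h0, h0']
    field_simp
  have c2 : cfNum (cfProdNum a a' (a 1 * a' 1)⁻¹) (cfProdDen a a') 2 =
      cfNum 1 a 2 / cfDen 1 a 2 * (cfNum 1 a' 2 / cfDen 1 a' 2) *
        cfDen (cfProdNum a a' (a 1 * a' 1)⁻¹) (cfProdDen a a') 2 := by
    have q2 : a 1 * a 2 + 1 ≠ 0 := by simpa [cfDen, mul_comm] using hQ 2
    have q2' : a' 2 * a' 1 + 1 ≠ 0 := by simpa [cfDen] using hQ' 2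
    simp only [cfDen, cfNum, cfProdNum, cfProdDen, h0, h0', Pi.one_apply]
    field_simp
    ring
  induction n using Nat.twoStepInduction with
  | zero => simp [cfNum, cfProdDen, h0']
  | one => exact c1
  | more n i0 i1 =>
    match n with
    | 0 => exact c2
    | 1 =>
      have d := cfDen_prod_succ h0 h0' h1 h1' 0
      have k := cfE_mul_sub hQ hQ' 1
      have d2 := cfDen_prod_two h0 h0' (a 1 * a' 1)⁻¹
      have d1 : (a 1 * a' 1)⁻¹ *
          cfDen (cfProdNum a a' (a 1 * a' 1)⁻¹) (cfProdDen a a') 1 = 1 := by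
        simp only [cfDen, cfProdDen]
        exact inv_mul_cancel₀ (mul_ne_zero h1 h1')
      simp only [zero_add, Nat.reduceAdd] at d k i1 ⊢
      rw [d, cfNum, c2, c1, d2, cfProdNum, cfProdDen]
      simp only [zero_add]
      linear_combination (-cfE a a' 2) * k + (cfE a a' 2 * cfF a a' 3 *
        (cfNum 1 a 1 / cfDen 1 a 1 * (cfNum 1 a' 1 / cfDen 1 a' 1))) * d1
    | n + 2 =>
      have d := cfDen_prod_succ h0 h0' h1 h1' (n + 1)
      have d' := cfDen_prod_succ h0 h0' h1 h1' n
      have k := cfE_mul_sub hQ hQ' (n + 2)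
      rw [show n + 2 + 2 = n + 1 + 3 by rfl, d, cfNum, show n + 1 + 1 = n + 2 by rfl, i1, i0,
        show n + 2 + 1 = n + 3 by rfl, show n + 1 + 2 = n + 3 by rfl, d', cfProdNum, cfProdDen]
      linear_combination (-cfE a a' (n + 3) *
        cfDen (cfProdNum a a' (a 1 * a' 1)⁻¹) (cfProdDen a a') (n + 2)) * k

end Product

/-! ### The simple continued fraction equivalent to the fraction-free one -/

/-- The factors of the equivalence transformation that turns the partial numerators `βz`,
`(q² - (n - 1)²) z²` into ones. -/
noncomputable def scale (β q z : ℝ) : ℕ → ℝ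
  | 0 => 1
  | 1 => (β * z)⁻¹
  | n + 2 => scale β q z n / ((q ^ 2 - ((n : ℝ) + 1) ^ 2) * z ^ 2)

/-- The coefficients of the simple continued fraction equivalent to
`a₀ + βz / (1 + qz + (q² - 1²) z² / (3 + (q² - 2²) z² / (5 + ⋯)))`. -/
noncomputable def gaussCoeff (a₀ β q z : ℝ) : ℕ → ℝ
  | 0 => a₀
  | 1 => (1 + q * z) / (β * z)
  | n + 2 => (2 * n + 3) * scale β q z (n + 2) / scale β q z (n + 1)

section Scalar

variable {a₀ β q z : ℝ}

theorem sq_sub_succ_sq_neg (hq0 : 0 ≤ q) (hq1 : q < 1) (n : ℕ) :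
    q ^ 2 - ((n : ℝ) + 1) ^ 2 < 0 := by
  have : (0 : ℝ) ≤ n := n.cast_nonneg
  nlinarith

theorem scale_ne_zero (hβ : β ≠ 0) (hq0 : 0 ≤ q) (hq1 : q < 1) (hz : z ≠ 0) (n : ℕ) :
    scale β q z n ≠ 0 := by
  induction n using Nat.twoStepInduction with
  | zero => simp [scale]
  | one => simp [scale, hβ, hz]
  | more n h₀ _ =>
    exact div_ne_zero h₀ (mul_ne_zero (sq_sub_succ_sq_neg hq0 hq1 n).ne (pow_ne_zero 2 hz))

theorem scale_mul_scale_succ_pos (hβz : 0 < β * z) (hq0 : 0 ≤ q) (hq1 : q < 1) (n : ℕ) :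
    0 < (-1) ^ n * (scale β q z n * scale β q z (n + 1)) := by
  have hz : z ≠ 0 := right_ne_zero_of_mul hβz.ne'
  induction n with
  | zero => simpa only [scale, pow_zero, one_mul] using inv_pos.2 hβz
  | succ n ih =>
    have hneg : 0 < -((q ^ 2 - ((n : ℝ) + 1) ^ 2) * z ^ 2) := by
      have := mul_pos (neg_pos.2 (sq_sub_succ_sq_neg hq0 hq1 n)) (pow_pos (abs_pos.2 hz) 2)
      rw [sq_abs] at this
      linarith
    convert! div_pos ih hneg using 1
    rw [show scale β q z (n + 1 + 1) = scale β q z n / ((q ^ 2 - ((n : ℝ) + 1) ^ 2) * z ^ 2)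
      from rfl, pow_succ, div_neg]
    ring

theorem gaussCoeff_step (hβ : β ≠ 0) (hq0 : 0 ≤ q) (hq1 : q < 1) (hz : z ≠ 0) (n : ℕ)
    (x y : ℝ) :
    gaussCoeff a₀ β q z (n + 2) * (scale β q z (n + 1) * x) + scale β q z n * y =
      scale β q z (n + 2) *
        ((2 * (n : ℝ) + 3) * x + (q ^ 2 - ((n : ℝ) + 1) ^ 2) * z ^ 2 * y) := by
  have h1 := scale_ne_zero hβ hq0 hq1 hz (n + 1)
  have h2 : scale β q z n =
      scale β q z (n + 2) * ((q ^ 2 - ((n : ℝ) + 1) ^ 2) * z ^ 2) := by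
    rw [scale, div_mul_cancel₀]
    exact mul_ne_zero (sq_sub_succ_sq_neg hq0 hq1 n).ne (pow_ne_zero 2 hz)
  rw [h2, gaussCoeff]
  field_simp

theorem cfDen_gaussCoeff (hβ : β ≠ 0) (hq0 : 0 ≤ q) (hq1 : q < 1) (hz : z ≠ 0) (n : ℕ) :
    cfDen 1 (gaussCoeff a₀ β q z) n = scale β q z n * gaussSeq q z 1 (1 + q * z) n := by
  induction n using Nat.twoStepInduction with
  | zero => simp [cfDen, scale, gaussSeq]
  | one => simp [cfDen, scale, gaussSeq, gaussCoeff]; ring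
  | more n h₀ h₁ =>
    rw [cfDen, h₀, h₁, Pi.one_apply, one_mul, gaussCoeff_step hβ hq0 hq1 hz, gaussSeq]

theorem cfNum_gaussCoeff (hβ : β ≠ 0) (hq0 : 0 ≤ q) (hq1 : q < 1) (hz : z ≠ 0) (n : ℕ) :
    cfNum 1 (gaussCoeff a₀ β q z) n =
      scale β q z n * gaussSeq q z a₀ (a₀ * (1 + q * z) + β * z) n := by
  induction n using Nat.twoStepInduction with
  | zero => simp [cfNum, scale, gaussSeq, gaussCoeff]
  | one =>
    simp only [cfNum, scale, gaussSeq, gaussCoeff, Pi.one_apply]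
    field_simp
  | more n h₀ h₁ =>
    rw [cfNum, h₀, h₁, Pi.one_apply, one_mul, gaussCoeff_step hβ hq0 hq1 hz, gaussSeq]

theorem one_sub_le_one_add_mul (hq0 : 0 ≤ q) (hz : |z| < 1) : 1 - q ≤ 1 + q * z := by
  nlinarith [(abs_lt.1 hz).1]

theorem gaussSeq_den_pos (hq0 : 0 ≤ q) (hq1 : q < 1) (hz : |z| < 1) (n : ℕ) :
    0 < gaussSeq q z 1 (1 + q * z) n := by
  refine (Finset.prod_pos fun k _ => ?_).trans_le (gaussSeq_ge_prod hq0 hq1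
    ((sq_lt_one_iff_abs_lt_one z).2 hz) (one_sub_le_one_add_mul hq0 hz) n)
  have : (0 : ℝ) ≤ k := k.cast_nonneg
  linarith

theorem cfDen_gaussCoeff_ne_zero (hβ : β ≠ 0) (hq0 : 0 ≤ q) (hq1 : q < 1) (hz0 : z ≠ 0)
    (hz : |z| < 1) (n : ℕ) : cfDen 1 (gaussCoeff a₀ β q z) n ≠ 0 := by
  rw [cfDen_gaussCoeff hβ hq0 hq1 hz0]
  exact mul_ne_zero (scale_ne_zero hβ hq0 hq1 hz0 n) (gaussSeq_den_pos hq0 hq1 hz n).ne'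

/-- If the first two remainders `L D n - N n` are those of a multiple of the minimal solution, then
all of them are, and the convergents `N n / D n` tend to `L`. -/
theorem tendsto_gaussCoeff {L c : ℝ} (hβ : β ≠ 0) (hq0 : 0 ≤ q) (hq1 : q < 1) (hz0 : z ≠ 0)
    (hz : |z| < 1) (h₀ : L - a₀ = c * minSol q z 0)
    (h₁ : L * (1 + q * z) - (a₀ * (1 + q * z) + β * z) = c * minSol q z 1) :
    Filter.Tendsto
      (fun n => cfNum 1 (gaussCoeff a₀ β q z) n / cfDen 1 (gaussCoeff a₀ β q z) n)
      Filter.atTop (𝓝 L) := by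
  have hz2 : z ^ 2 < 1 := (sq_lt_one_iff_abs_lt_one z).2 hz
  have hlim := (tendsto_minSol_div hq0 hq1 hz0 hz2 (one_sub_le_one_add_mul hq0 hz)).const_mul c
  rw [mul_zero] at hlim
  have := hlim.const_sub L
  rw [sub_zero] at this
  refine this.congr fun n => ?_
  have hD := (gaussSeq_den_pos hq0 hq1 hz n).ne'
  have hs := scale_ne_zero hβ hq0 hq1 hz0 n
  have lin : L * gaussSeq q z 1 (1 + q * z) n -
      gaussSeq q z a₀ (a₀ * (1 + q * z) + β * z) n = c * minSol q z n := by
    have e1 := gaussSeq_linear q z L (-1) 1 (1 + q * z) a₀ (a₀ * (1 + q * z) + β * z) n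
    have e2 := gaussSeq_linear q z c 0 (minSol q z 0) (minSol q z 1) 0 0 n
    rw [gaussSeq_minSol hq0 hq1 hz2] at e2
    rw [show L * 1 + -1 * a₀ = c * minSol q z 0 + 0 * 0 by rw [← h₀]; ring,
      show L * (1 + q * z) + -1 * (a₀ * (1 + q * z) + β * z) = c * minSol q z 1 + 0 * 0 by
        rw [← h₁]; ring, e2] at e1
    linear_combination -e1
  rw [cfNum_gaussCoeff hβ hq0 hq1 hz0, cfDen_gaussCoeff hβ hq0 hq1 hz0, mul_div_mul_left _ _ hs,
    mul_div_assoc', ← lin]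
  field_simp
  ring

/-- For `z < 0` the two products in the middle factor of `F n` are both nonzero of sign
`(-1) ^ (n - 1)`, so they cannot cancel. -/
theorem cfF_gaussCoeff_ne_zero (hq0 : 0 < q) (hq1 : q < 1) (hz0 : z < 0) (hz : |z| < 1) (n : ℕ) :
    cfF (gaussCoeff 1 (-2 * q) q z) (gaussCoeff 0 (-2) 0 z) (n + 2) ≠ 0 := by
  have hz2 : z ^ 2 < 1 := (sq_lt_one_iff_abs_lt_one z).2 hz
  have hβ : -2 * q ≠ 0 := by linarith
  have hβ' : (-2 : ℝ) ≠ 0 := by norm_num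
  refine mul_ne_zero (mul_ne_zero
    (cfDen_gaussCoeff_ne_zero hβ hq0.le hq1 hz0.ne hz _)
    (cfDen_gaussCoeff_ne_zero hβ' le_rfl one_pos hz0.ne hz _)) ?_
  simp only [show n + 2 - 1 = n + 1 by omega]
  rw [cfDen_gaussCoeff hβ hq0.le hq1 hz0.ne, cfDen_gaussCoeff hβ' le_rfl one_pos hz0.ne,
    cfNum_gaussCoeff hβ hq0.le hq1 hz0.ne, cfNum_gaussCoeff hβ' le_rfl one_pos hz0.ne]
  have hs := scale_mul_scale_succ_pos (z := z) (β := -2 * q) (by nlinarith) hq0.le hq1 (n + 1)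
  have hs' := scale_mul_scale_succ_pos (z := z) (β := -2) (by linarith) le_rfl one_pos (n + 1)
  have hD := gaussSeq_den_pos hq0.le hq1 hz (n + 2)
  have hD' := gaussSeq_den_pos (q := 0) le_rfl one_pos hz (n + 1)
  have hN := (gaussSeq_growth (f₀ := 1) (f₁ := 1 * (1 + q * z) + -2 * q * z) hq0.le hq1 hz2
    zero_le_one (by nlinarith) (by nlinarith) n).1
  have hN' := (gaussSeq_growth (q := 0) (z := z) (f₀ := 0) (f₁ := 0 * (1 + 0 * z) + -2 * z)
    le_rfl one_pos hz2 le_rfl (by linarith) (by linarith) (n + 1)).1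
  have := add_pos (mul_pos hs (mul_pos hD hN)) (mul_pos hs' (mul_pos hD' hN'))
  refine right_ne_zero_of_mul (a := (-1 : ℝ) ^ (n + 1)) (ne_of_gt (this.trans_eq ?_))
  ring

theorem evenProd_ne_zero (hq0 : 0 ≤ q) (hq1 : q < 1) (k : ℕ) : evenProd q k ≠ 0 := by
  refine Finset.prod_ne_zero_iff.2 fun j hj => ?_
  have : (1 : ℝ) ≤ j := by exact_mod_cast (Finset.mem_Icc.1 hj).1
  nlinarith

theorem oddProd_ne_zero (hq0 : 0 ≤ q) (hq1 : q < 1) (k : ℕ) : oddProd q k ≠ 0 := by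
  refine Finset.prod_ne_zero_iff.2 fun j hj => ?_
  have : (1 : ℝ) ≤ j := by exact_mod_cast (Finset.mem_Icc.1 hj).1
  nlinarith

theorem evenProd_zero_left (k : ℕ) : evenProd 0 k = (-1) ^ k * evenFac k ^ 2 := by
  have : ∀ j ∈ Finset.Icc 1 k, (0 : ℝ) ^ 2 - (2 * (j : ℝ)) ^ 2 = -1 * (2 * (j : ℝ)) ^ 2 :=
    fun j _ => by ring
  rw [evenProd, evenFac, Finset.prod_congr rfl this, Finset.prod_mul_distrib, Finset.prod_const,
    Nat.card_Icc, Nat.add_sub_cancel, Finset.prod_pow]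

theorem oddProd_zero_left (k : ℕ) : oddProd 0 k = (-1) ^ k * oddFac k ^ 2 := by
  have : ∀ j ∈ Finset.Icc 1 k, (0 : ℝ) ^ 2 - (2 * (j : ℝ) - 1) ^ 2 = -1 * (2 * (j : ℝ) - 1) ^ 2 :=
    fun j _ => by ring
  rw [oddProd, oddFac, Finset.prod_congr rfl this, Finset.prod_mul_distrib, Finset.prod_const,
    Nat.card_Icc, Nat.add_sub_cancel, Finset.prod_pow]

theorem scale_closed (β q z : ℝ) (k : ℕ) :
    scale β q z (2 * k) = (oddProd q k * z ^ (2 * k))⁻¹ ∧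
      scale β q z (2 * k + 1) = (β * evenProd q k * z ^ (2 * k + 1))⁻¹ := by
  induction k with
  | zero => simp [scale, oddProd, evenProd]
  | succ k ih =>
    have ho : oddProd q (k + 1) = oddProd q k * (q ^ 2 - (2 * (k : ℝ) + 1) ^ 2) := by
      rw [oddProd, Finset.prod_Icc_succ_top (by omega), ← oddProd]
      push_cast
      ring
    have he : evenProd q (k + 1) = evenProd q k * (q ^ 2 - (2 * (k : ℝ) + 1 + 1) ^ 2) := by
      rw [evenProd, Finset.prod_Icc_succ_top (by omega), ← evenProd]
      push_cast
      ring
    constructor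
    · rw [show 2 * (k + 1) = 2 * k + 2 by ring, scale, ih.1, ho, div_eq_mul_inv, ← mul_inv]
      push_cast
      ring
    · rw [show 2 * (k + 1) + 1 = 2 * k + 1 + 2 by ring, scale, ih.2, he, div_eq_mul_inv,
        ← mul_inv]
      push_cast
      ring

theorem gaussCoeff_even (hq0 : 0 ≤ q) (hq1 : q < 1) (hz : z ≠ 0) (k : ℕ) :
    gaussCoeff a₀ β q z (2 * k + 2) =
      β * evenProd q k / oddProd q (k + 1) * (4 * ((k + 1 : ℕ) : ℝ) - 1) / z := by
  have ho := oddProd_ne_zero hq0 hq1 (k + 1)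
  rw [gaussCoeff, (scale_closed β q z k).2, ← mul_add_one, (scale_closed β q z (k + 1)).1]
  push_cast
  field_simp
  ring

theorem gaussCoeff_odd (hq0 : 0 ≤ q) (hq1 : q < 1) (hz : z ≠ 0) (k : ℕ) :
    gaussCoeff a₀ β q z (2 * k + 3) =
      oddProd q (k + 1) / (β * evenProd q (k + 1)) * (4 * ((k + 1 : ℕ) : ℝ) + 1) / z := by
  have ho := oddProd_ne_zero hq0 hq1 (k + 1)
  have he := evenProd_ne_zero hq0 hq1 (k + 1)
  rw [show 2 * k + 3 = (2 * k + 1) + 2 by ring, gaussCoeff,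
    show 2 * k + 1 + 2 = 2 * (k + 1) + 1 by ring, (scale_closed β q z (k + 1)).2,
    show 2 * k + 1 + 1 = 2 * (k + 1) by ring, (scale_closed β q z (k + 1)).1]
  push_cast
  field_simp
  ring

end Scalar

/-! ### Reduction of matrices to their eigenvalues -/

section Spectral

variable {m : ℕ}

/-- A positive definite matrix is the image of the tuple of its eigenvalues under an injective
algebra homomorphism (diagonal matrices, conjugated by an orthogonal matrix). -/
theorem exists_spectral_algHom {A : Matrix (Fin m) (Fin m) ℝ} (hA : A.PosDef) :
    ∃ (Φ : (Fin m → ℝ) →ₐ[ℝ] Matrix (Fin m) (Fin m) ℝ) (x : Fin m → ℝ),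
      Function.Injective Φ ∧ A = Φ x ∧ (∀ i, 0 < x i) ∧ ((A - 1).PosDef → ∀ i, 1 < x i) := by
  let U := Unitary.conjStarAlgAut ℝ (Matrix (Fin m) (Fin m) ℝ) hA.isHermitian.eigenvectorUnitary
  refine ⟨U.toAlgEquiv.toAlgHom.comp (Matrix.diagonalAlgHom ℝ), hA.isHermitian.eigenvalues,
    ?_, ?_, hA.eigenvalues_pos, fun h i => ?_⟩
  · exact U.injective.comp Matrix.diagonal_injective
  · exact hA.isHermitian.spectral_theorem
  · set v := hA.isHermitian.eigenvectorBasis i with hv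
    have hv0 : (⇑v : Fin m → ℝ) ≠ 0 := fun h0 => by
      have : v = 0 := by ext j; exact congrFun h0 j
      exact hA.isHermitian.eigenvectorBasis.orthonormal.ne_zero i this
    have h1 := h.dotProduct_mulVec_pos hv0
    have sub_one_smul (c : ℝ) (w : Fin m → ℝ) : (c - 1) • w = c • w - w := by
      rw [sub_smul, one_smul]
    rw [Matrix.sub_mulVec, Matrix.one_mulVec, hA.isHermitian.mulVec_eigenvectorBasis i, ← hv,
      ← sub_one_smul, dotProduct_smul, smul_eq_mul] at h1
    have h2 : 0 ≤ star (⇑v : Fin m → ℝ) ⬝ᵥ ⇑v := dotProduct_star_self_nonneg _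
    linarith [pos_of_mul_pos_left h1 h2]

variable {Φ : (Fin m → ℝ) →ₐ[ℝ] Matrix (Fin m) (Fin m) ℝ}

theorem isUnit_map_iff (hΦ : Function.Injective Φ) (d : Fin m → ℝ) :
    IsUnit (Φ d) ↔ ∀ i, d i ≠ 0 := by
  refine ⟨fun h i hi => ?_, fun h => IsUnit.map Φ (Pi.isUnit_iff.2 fun i => (h i).isUnit)⟩
  have h0 : d * Pi.single i 1 = 0 := by
    ext j
    rcases eq_or_ne j i with rfl | hj
    · simp [hi]
    · simp [hj]
  have h1 : Φ d * Φ (Pi.single i 1) = 0 := by rw [← map_mul, h0, map_zero]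
  have h2 := hΦ ((h.mul_right_eq_zero.1 h1).trans (map_zero Φ).symm)
  simpa using congrFun h2 i

theorem map_inv_of_ne_zero (Φ : (Fin m → ℝ) →ₐ[ℝ] Matrix (Fin m) (Fin m) ℝ) {d : Fin m → ℝ}
    (h : ∀ i, d i ≠ 0) : (Φ d)⁻¹ = Φ fun i => (d i)⁻¹ := by
  refine Matrix.inv_eq_right_inv ?_
  rw [← map_mul, ← map_one Φ]
  congr 1
  ext i
  exact mul_inv_cancel₀ (h i)

theorem frac_map (Φ : (Fin m → ℝ) →ₐ[ℝ] Matrix (Fin m) (Fin m) ℝ) (c : Fin m → ℝ)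
    {d : Fin m → ℝ} (h : ∀ i, d i ≠ 0) : frac (Φ c) (Φ d) = Φ fun i => c i / d i := by
  rw [frac, map_inv_of_ne_zero Φ h, ← map_mul]
  congr 1
  ext i
  simp [div_eq_inv_mul]

theorem continuous_algHom (Φ : (Fin m → ℝ) →ₐ[ℝ] Matrix (Fin m) (Fin m) ℝ) : Continuous Φ :=
  Φ.toLinearMap.continuous_of_finiteDimensional

theorem num_eq_cfNum (b a : ℕ → Matrix (Fin m) (Fin m) ℝ) (n : ℕ) : num b a n = cfNum b a n := by
  induction n using Nat.twoStepInduction with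
  | zero => rfl
  | one => rfl
  | more n h₀ h₁ => rw [num, cfNum, h₀, h₁]

theorem den_eq_cfDen (b a : ℕ → Matrix (Fin m) (Fin m) ℝ) (n : ℕ) : den b a n = cfDen b a n := by
  induction n using Nat.twoStepInduction with
  | zero => rfl
  | one => rfl
  | more n h₀ h₁ => rw [den, cfDen, h₀, h₁]

/-- Continued fractions can be evaluated eigenvalue by eigenvalue. -/
theorem isContFrac_map (hΦ : Function.Injective Φ) {b a : ℕ → Matrix (Fin m) (Fin m) ℝ}
    (b' a' : ℕ → Fin m → ℝ) (hb : ∀ n, b n = Φ (b' n)) (ha : ∀ n, a n = Φ (a' n))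
    {L : Fin m → ℝ} (hden : ∀ i n, cfDen (fun k => b' k i) (fun k => a' k i) n ≠ 0)
    (hlim : ∀ i, Filter.Tendsto (fun n => cfNum (fun k => b' k i) (fun k => a' k i) n /
      cfDen (fun k => b' k i) (fun k => a' k i) n) Filter.atTop (𝓝 (L i))) :
    IsContFrac b a (Φ L) := by
  obtain rfl : b = fun n => Φ (b' n) := funext hb
  obtain rfl : a = fun n => Φ (a' n) := funext ha
  have hD (n : ℕ) : den (fun n => Φ (b' n)) (fun n => Φ (a' n)) n = Φ (cfDen b' a' n) := by
    rw [den_eq_cfDen]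
    exact (map_cfDen Φ.toRingHom b' a' n).symm
  have hN (n : ℕ) : num (fun n => Φ (b' n)) (fun n => Φ (a' n)) n = Φ (cfNum b' a' n) := by
    rw [num_eq_cfNum]
    exact (map_cfNum Φ.toRingHom b' a' n).symm
  have hDi (n : ℕ) (i : Fin m) :
      cfDen b' a' n i = cfDen (fun k => b' k i) (fun k => a' k i) n :=
    map_cfDen (Pi.evalRingHom (fun _ : Fin m => ℝ) i) b' a' n
  have hNi (n : ℕ) (i : Fin m) :
      cfNum b' a' n i = cfNum (fun k => b' k i) (fun k => a' k i) n :=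
    map_cfNum (Pi.evalRingHom (fun _ : Fin m => ℝ) i) b' a' n
  have hne (n : ℕ) (i : Fin m) : cfDen b' a' n i ≠ 0 := by
    rw [hDi]
    exact hden i n
  refine ⟨fun n => ?_, ?_⟩
  · rw [hD, isUnit_map_iff hΦ]
    exact hne n
  · simp only [hD, hN, frac_map Φ _ (hne _)]
    refine ((continuous_algHom Φ).tendsto L).comp (tendsto_pi_nhds.2 fun i => ?_)
    simpa only [hDi, hNi] using hlim i

/-! ### The matrix functions at the eigenvalues -/

/-- The value of `φ` at an eigenvalue. -/
noncomputable def cayley (x : ℝ) : ℝ := (1 - x) / (1 + x)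

theorem cayley_facts {x : ℝ} (hx : 0 < x) :
    1 + cayley x = 2 / (1 + x) ∧ 1 - cayley x = 2 * x / (1 + x) ∧ |cayley x| < 1 := by
  have h : 0 < 1 + x := by linarith
  have h1 : 1 + cayley x = 2 / (1 + x) := by
    rw [cayley]
    field_simp
    ring
  have h2 : 1 - cayley x = 2 * x / (1 + x) := by
    rw [cayley]
    field_simp
    ring
  have p1 : 0 < 2 / (1 + x) := by positivity
  have p2 : 0 < 2 * x / (1 + x) := by positivity
  exact ⟨h1, h2, abs_lt.2 ⟨by linarith, by linarith⟩⟩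

theorem cayley_ne_zero {x : ℝ} (hx : 0 < x) (hx1 : x ≠ 1) : cayley x ≠ 0 :=
  div_ne_zero (sub_ne_zero.2 hx1.symm) (by linarith)

theorem log_sub_log_cayley {x : ℝ} (hx : 0 < x) :
    Real.log (1 + cayley x) - Real.log (1 - cayley x) = -Real.log x := by
  obtain ⟨h1, h2, -⟩ := cayley_facts hx
  have h : 0 < 1 + x := by linarith
  rw [h1, h2, mul_div_right_comm, Real.log_mul (by positivity) hx.ne']
  ring

theorem rpow_mul_rpow_cayley {x : ℝ} (hx : 0 < x) (q : ℝ) :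
    x ^ q * (1 + cayley x) ^ q = (1 - cayley x) ^ q := by
  obtain ⟨h1, h2, -⟩ := cayley_facts hx
  rw [h1, h2, ← Real.mul_rpow hx.le (by positivity)]
  congr 1
  ring

variable {x : Fin m → ℝ}

theorem phi_map (Φ : (Fin m → ℝ) →ₐ[ℝ] Matrix (Fin m) (Fin m) ℝ) (hx : ∀ i, 0 < x i) :
    phi (Φ x) = Φ fun i => cayley (x i) := by
  rw [phi, ← map_one Φ, ← map_sub, ← map_add, frac_map Φ _ fun i => ?_]
  · rfl
  · have := hx i
    simp only [Pi.add_apply, Pi.one_apply]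
    linarith

theorem hasSum_lnTerm (Φ : (Fin m → ℝ) →ₐ[ℝ] Matrix (Fin m) (Fin m) ℝ) (hx : ∀ i, 0 < x i) :
    HasSum (lnTerm (Φ x)) (Φ fun i => -Real.log (x i) / 2) := by
  have h : HasSum (fun (n : ℕ) (i : Fin m) =>
      1 / (2 * (n : ℝ) + 1) * cayley (x i) ^ (2 * n + 1)) fun i => -Real.log (x i) / 2 := by
    refine Pi.hasSum.2 fun i => ?_
    rw [← log_sub_log_cayley (hx i)]
    exact hasSum_log_term (cayley_facts (hx i)).2.2
  convert! h.map Φ (continuous_algHom Φ) using 1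
  funext n
  rw [lnTerm, phi_map Φ hx, ← map_pow, ← map_smul]
  rfl

theorem ln_map (Φ : (Fin m → ℝ) →ₐ[ℝ] Matrix (Fin m) (Fin m) ℝ) (hx : ∀ i, 0 < x i) :
    ln (Φ x) = Φ fun i => Real.log (x i) := by
  rw [ln, (hasSum_lnTerm Φ hx).tsum_eq, ← map_smul]
  congr 1
  ext i
  simp only [Pi.smul_apply, smul_eq_mul]
  ring

theorem exp_map (Φ : (Fin m → ℝ) →ₐ[ℝ] Matrix (Fin m) (Fin m) ℝ) (d : Fin m → ℝ) :
    NormedSpace.exp (Φ d) = Φ fun i => Real.exp (d i) := by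
  -- `NormedSpace.map_exp` needs a norm; the `L∞` operator norm induces the product topology.
  let _ : NormedRing (Matrix (Fin m) (Fin m) ℝ) := Matrix.linftyOpNormedRing
  let _ : NormedAlgebra ℝ (Matrix (Fin m) (Fin m) ℝ) := Matrix.linftyOpNormedAlgebra
  refine (NormedSpace.map_exp Φ (continuous_algHom Φ) d).symm.trans ?_
  congr 1
  ext i
  rw [Pi.coe_exp, Real.exp_eq_exp_ℝ]

theorem pow_map (Φ : (Fin m → ℝ) →ₐ[ℝ] Matrix (Fin m) (Fin m) ℝ) (hx : ∀ i, 0 < x i) (q : ℝ) :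
    pow (Φ x) q = Φ fun i => x i ^ q := by
  rw [pow, ln_map Φ hx, ← map_smul, exp_map]
  congr 1
  ext i
  rw [Real.rpow_def_of_pos (hx i), mul_comm]
  rfl

theorem frac_smul_one_phi (Φ : (Fin m → ℝ) →ₐ[ℝ] Matrix (Fin m) (Fin m) ℝ) (hx : ∀ i, 0 < x i)
    (hx1 : ∀ i, x i ≠ 1) (c : ℝ) :
    frac (c • 1) (phi (Φ x)) = Φ fun i => c / cayley (x i) := by
  rw [phi_map Φ hx, ← map_one Φ, ← map_smul,
    frac_map Φ _ fun i => cayley_ne_zero (hx i) (hx1 i)]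
  simp

theorem powCoeff_map (Φ : (Fin m → ℝ) →ₐ[ℝ] Matrix (Fin m) (Fin m) ℝ) (hx : ∀ i, 0 < x i)
    (hx1 : ∀ i, x i ≠ 1) {q : ℝ} (hq0 : 0 < q) (hq1 : q < 1) (n : ℕ) :
    powCoeff q (Φ x) n = Φ fun i => gaussCoeff 1 (-2 * q) q (cayley (x i)) n := by
  have hz (i : Fin m) := cayley_ne_zero (hx i) (hx1 i)
  match n with
  | 0 => exact (map_one Φ).symm
  | 1 =>
    rw [powCoeff, if_neg one_ne_zero, if_pos rfl, phi_map Φ hx, ← map_smul, ← map_smul,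
      ← map_one Φ, ← map_neg, ← map_sub, frac_map Φ _ fun i => ?_]
    · congr 1
      ext i
      have := hz i
      simp only [gaussCoeff, Pi.sub_apply, Pi.neg_apply, Pi.one_apply, Pi.smul_apply, smul_eq_mul]
      field_simp
      ring
    · exact mul_ne_zero (by positivity) (hz i)
  | n + 2 =>
    rcases Nat.even_or_odd' n with ⟨k, rfl | rfl⟩
    · rw [powCoeff, if_neg (by omega), if_neg (by omega),
        if_pos ((even_two_mul k).add even_two), show (2 * k + 2) / 2 = k + 1 by omega,
        Nat.add_sub_cancel, frac_smul_one_phi Φ hx hx1]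
      congr 1
      ext i
      rw [gaussCoeff_even hq0.le hq1 (hz i)]
      ring
    · rw [powCoeff, if_neg (by omega), if_neg (by omega),
        if_neg (by rw [Nat.not_even_iff_odd]; exact (odd_two_mul_add_one k).add_even even_two),
        show (2 * k + 1 + 2) / 2 = k + 1 by omega, frac_smul_one_phi Φ hx hx1]
      congr 1
      ext i
      rw [show 2 * k + 1 + 2 = 2 * k + 3 by ring, gaussCoeff_odd hq0.le hq1 (hz i),
        show -2 * q * evenProd q (k + 1) = -(2 * q * evenProd q (k + 1)) by ring, div_neg, neg_div]

theorem lnCoeff_map (Φ : (Fin m → ℝ) →ₐ[ℝ] Matrix (Fin m) (Fin m) ℝ) (hx : ∀ i, 0 < x i)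
    (hx1 : ∀ i, x i ≠ 1) (n : ℕ) :
    lnCoeff (Φ x) n = Φ fun i => gaussCoeff 0 (-2) 0 (cayley (x i)) n := by
  have hz (i : Fin m) := cayley_ne_zero (hx i) (hx1 i)
  have hs (k : ℕ) : ((-1 : ℝ) ^ k) ≠ 0 := pow_ne_zero k (by norm_num)
  match n with
  | 0 => exact (map_zero Φ).symm
  | 1 =>
    rw [lnCoeff, if_neg one_ne_zero, if_pos rfl, phi_map Φ hx, ← map_smul,
      map_inv_of_ne_zero Φ (d := (-2 : ℝ) • fun i => cayley (x i))
        fun i => mul_ne_zero (by norm_num) (hz i)]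
    congr 1
    ext i
    simp [gaussCoeff]
  | n + 2 =>
    rcases Nat.even_or_odd' n with ⟨k, rfl | rfl⟩
    · rw [lnCoeff, if_neg (by omega), if_neg (by omega),
        if_pos ((even_two_mul k).add even_two), show (2 * k + 2) / 2 = k + 1 by omega,
        Nat.add_sub_cancel, frac_smul_one_phi Φ hx hx1]
      congr 1
      ext i
      rw [gaussCoeff_even le_rfl one_pos (hz i), evenProd_zero_left, oddProd_zero_left,
        show -2 * ((-1) ^ k * evenFac k ^ 2) = (-1) ^ (k + 1) * (2 * evenFac k ^ 2) by ring,
        mul_div_mul_left _ _ (hs _)]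
    · rw [lnCoeff, if_neg (by omega), if_neg (by omega),
        if_neg (by rw [Nat.not_even_iff_odd]; exact (odd_two_mul_add_one k).add_even even_two),
        show (2 * k + 1 + 2) / 2 = k + 1 by omega, frac_smul_one_phi Φ hx hx1]
      congr 1
      ext i
      rw [show 2 * k + 1 + 2 = 2 * k + 3 by ring, gaussCoeff_odd le_rfl one_pos (hz i),
        evenProd_zero_left, oddProd_zero_left,
        show -2 * ((-1) ^ (k + 1) * evenFac (k + 1) ^ 2) =
          (-1) ^ (k + 1) * (-(2 * evenFac (k + 1) ^ 2)) by ring,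
        mul_div_mul_left _ _ (hs _), div_neg, neg_div]

theorem E_eq_cfE (q : ℝ) (A : Matrix (Fin m) (Fin m) ℝ) (n : ℕ) :
    E q A n = cfE (powCoeff q A) (lnCoeff A) n := by
  simp only [E, cfE, powP, powQ, lnP, lnQ, num_eq_cfNum, den_eq_cfDen]
  rfl

theorem F_eq_cfF (q : ℝ) (A : Matrix (Fin m) (Fin m) ℝ) (n : ℕ) :
    F q A n = cfF (powCoeff q A) (lnCoeff A) n := by
  simp only [F, cfF, powP, powQ, lnP, lnQ, num_eq_cfNum, den_eq_cfDen]
  rfl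

theorem prodNum_eq_cfProdNum (q : ℝ) (A : Matrix (Fin m) (Fin m) ℝ) (n : ℕ) :
    prodNum q A n =
      cfProdNum (powCoeff q A) (lnCoeff A) (powCoeff q A 1 * lnCoeff A 1)⁻¹ n := by
  match n with
  | 0 | 1 | 2 => rfl
  | 3 | n + 4 => simp only [prodNum, cfProdNum, E_eq_cfE, F_eq_cfF]

theorem prodDen_eq_cfProdDen (q : ℝ) (A : Matrix (Fin m) (Fin m) ℝ) (n : ℕ) :
    prodDen q A n = cfProdDen (powCoeff q A) (lnCoeff A) n := by
  match n with
  | 0 | 1 | 2 => rfl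
  | n + 3 => simp only [prodDen, cfProdDen, E_eq_cfE, F_eq_cfF]

end Spectral

/-! ### The three continued fractions at an eigenvalue -/

theorem tendsto_pow {x q : ℝ} (hx : 0 < x) (hx1 : x ≠ 1) (hq0 : 0 < q) (hq1 : q < 1) :
    Filter.Tendsto (fun n => cfNum 1 (gaussCoeff 1 (-2 * q) q (cayley x)) n /
      cfDen 1 (gaussCoeff 1 (-2 * q) q (cayley x)) n) Filter.atTop (𝓝 (x ^ q)) := by
  obtain ⟨h1, -, hz⟩ := cayley_facts hx
  obtain ⟨m0, m1⟩ := minSol_eq_rpow hq0 hq1 hz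
  have hp : 0 < (1 + cayley x) ^ q := Real.rpow_pos_of_pos (by rw [h1]; positivity) q
  rw [← rpow_mul_rpow_cayley hx] at m0 m1
  refine tendsto_gaussCoeff (c := -2 * q / (1 + cayley x) ^ q) (by linarith) hq0.le hq1
    (cayley_ne_zero hx hx1) hz ?_ ?_
  · field_simp
    linear_combination m0
  · field_simp
    linear_combination m1

theorem tendsto_log {x : ℝ} (hx : 0 < x) (hx1 : x ≠ 1) :
    Filter.Tendsto (fun n => cfNum 1 (gaussCoeff 0 (-2) 0 (cayley x)) n /
      cfDen 1 (gaussCoeff 0 (-2) 0 (cayley x)) n) Filter.atTop (𝓝 (Real.log x)) := by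
  obtain ⟨h1, -, hz⟩ := cayley_facts hx
  obtain ⟨m0, m1⟩ := minSol_eq_log hz
  rw [log_sub_log_cayley hx] at m0 m1
  refine tendsto_gaussCoeff (c := -2) (by norm_num) le_rfl one_pos (cayley_ne_zero hx hx1) hz ?_ ?_
  · linear_combination m0
  · linear_combination m1

/-- The product continued fraction at an eigenvalue, provided that no `F n` vanishes there. -/
theorem prod_contFrac {x q : ℝ} (hx : 0 < x) (hx1 : x ≠ 1) (hq0 : 0 < q) (hq1 : q < 1)
    {a a' : ℕ → ℝ} (ha : a = gaussCoeff 1 (-2 * q) q (cayley x))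
    (ha' : a' = gaussCoeff 0 (-2) 0 (cayley x)) (hF : ∀ n, 2 ≤ n → cfF a a' n ≠ 0) :
    (∀ n, cfDen (cfProdNum a a' (a 1 * a' 1)⁻¹) (cfProdDen a a') n ≠ 0) ∧
      Filter.Tendsto (fun n => cfNum (cfProdNum a a' (a 1 * a' 1)⁻¹) (cfProdDen a a') n /
        cfDen (cfProdNum a a' (a 1 * a' 1)⁻¹) (cfProdDen a a') n) Filter.atTop
        (𝓝 (x ^ q * Real.log x)) := by
  have hz := (cayley_facts hx).2.2
  have hz0 := cayley_ne_zero hx hx1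
  have hQ (n : ℕ) : cfDen 1 a n ≠ 0 := by
    rw [ha]
    exact cfDen_gaussCoeff_ne_zero (by linarith) hq0.le hq1 hz0 hz n
  have hQ' (n : ℕ) : cfDen 1 a' n ≠ 0 := by
    rw [ha']
    exact cfDen_gaussCoeff_ne_zero (by norm_num) le_rfl one_pos hz0 hz n
  have h0 : a 0 = 1 := by rw [ha, gaussCoeff]
  have h0' : a' 0 = 0 := by rw [ha', gaussCoeff]
  have h1 : a 1 ≠ 0 := hQ 1
  have h1' : a' 1 ≠ 0 := hQ' 1
  have h2 : a 1 + 1 ≠ 0 := by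
    have e : a 1 + 1 = (1 - q * cayley x) / (-2 * q * cayley x) := by
      rw [ha, gaussCoeff]
      field_simp
      ring
    rw [e]
    refine div_ne_zero ?_ (mul_ne_zero (by linarith) hz0)
    have := (abs_lt.1 hz).2
    nlinarith
  have hne := cfDen_prod_ne_zero h0 h0' h1 h1' (cfE_ne_zero h0 h0' h2 hQ hQ' hF)
  refine ⟨hne, ?_⟩
  have := (tendsto_pow hx hx1 hq0 hq1).mul (tendsto_log hx hx1)
  rw [← ha, ← ha'] at this
  refine this.congr fun n => ?_
  rw [cfNum_prod h0 h0' h1 h1' hQ hQ', mul_div_cancel_right₀ _ (hne n)]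

end MatCF

theorem theorem3p1 (m : ℕ) (A : Matrix (Fin m) (Fin m) ℝ) (hA : A.PosDef)
    (hA1 : IsUnit (1 - A)) (q : ℝ) (hq0 : 0 < q) (hq1 : q < 1) :
    Summable (MatCF.lnTerm A) ∧
    MatCF.IsContFrac MatCF.ones (MatCF.powCoeff q A) (MatCF.pow A q) ∧
    MatCF.IsContFrac MatCF.ones (MatCF.lnCoeff A) (MatCF.ln A) ∧
    ((∀ n, 2 ≤ n → IsUnit (MatCF.F q A n)) →
      MatCF.IsContFrac (MatCF.prodNum q A) (MatCF.prodDen q A) (MatCF.pow A q * MatCF.ln A)) ∧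
    ((A - 1).PosDef → ∀ n, 2 ≤ n → IsUnit (MatCF.F q A n)) := by
  open MatCF in
  obtain ⟨Φ, x, hΦ, rfl, hx, hx'⟩ := exists_spectral_algHom hA
  have hx1 (i : Fin m) : x i ≠ 1 := by
    rw [← map_one Φ, ← map_sub, isUnit_map_iff hΦ] at hA1
    exact fun h => hA1 i (by simp [h])
  have hz (i : Fin m) := (cayley_facts (hx i)).2.2
  have hz0 (i : Fin m) := cayley_ne_zero (hx i) (hx1 i)
  set a : ℕ → Fin m → ℝ := fun n i => gaussCoeff 1 (-2 * q) q (cayley (x i)) n with ha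
  set a' : ℕ → Fin m → ℝ := fun n i => gaussCoeff 0 (-2) 0 (cayley (x i)) n with ha'
  have hp : powCoeff q (Φ x) = fun n => Φ (a n) := funext (powCoeff_map Φ hx hx1 hq0 hq1)
  have hl : lnCoeff (Φ x) = fun n => Φ (a' n) := funext (lnCoeff_map Φ hx hx1)
  have hF (n : ℕ) : F q (Φ x) n = Φ (cfF a a' n) := by
    rw [F_eq_cfF, hp, hl]
    exact (map_cfF Φ.toRingHom a a' n).symm
  have hFi (n : ℕ) (i : Fin m) : cfF a a' n i = cfF (a · i) (a' · i) n :=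
    map_cfF (Pi.evalRingHom (fun _ : Fin m => ℝ) i) a a' n
  refine ⟨(hasSum_lnTerm Φ hx).summable, ?_, ?_, fun h => ?_, fun h n hn => ?_⟩
  · rw [pow_map Φ hx]
    exact isContFrac_map hΦ 1 a (fun n => (map_one Φ).symm) (congrFun hp)
      (fun i => cfDen_gaussCoeff_ne_zero (by linarith) hq0.le hq1 (hz0 i) (hz i))
      fun i => tendsto_pow (hx i) (hx1 i) hq0 hq1
  · rw [ln_map Φ hx]
    exact isContFrac_map hΦ 1 a' (fun n => (map_one Φ).symm) (congrFun hl)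
      (fun i => cfDen_gaussCoeff_ne_zero (by norm_num) le_rfl one_pos (hz0 i) (hz i))
      fun i => tendsto_log (hx i) (hx1 i)
  · have hFne (i : Fin m) (n : ℕ) (hn : 2 ≤ n) : cfF (a · i) (a' · i) n ≠ 0 := by
      rw [← hFi]
      exact (isUnit_map_iff hΦ _).1 (hF n ▸ h n hn) i
    have hprod (i : Fin m) := prod_contFrac (hx i) (hx1 i) hq0 hq1 rfl rfl (hFne i)
    have hinv (i : Fin m) : a 1 i * a' 1 i ≠ 0 := mul_ne_zero
      (cfDen_gaussCoeff_ne_zero (a₀ := 1) (by linarith) hq0.le hq1 (hz0 i) (hz i) 1)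
      (cfDen_gaussCoeff_ne_zero (a₀ := 0) (by norm_num) le_rfl one_pos (hz0 i) (hz i) 1)
    have hN (n : ℕ) : prodNum q (Φ x) n =
        Φ (cfProdNum a a' (fun i => (a 1 i * a' 1 i)⁻¹) n) := by
      rw [prodNum_eq_cfProdNum, hp, hl, ← map_mul]
      have e := map_inv_of_ne_zero Φ (d := a 1 * a' 1) hinv
      rw [e]
      exact (map_cfProdNum Φ.toRingHom a a' _ n).symm
    have hD (n : ℕ) : prodDen q (Φ x) n = Φ (cfProdDen a a' n) := by
      rw [prodDen_eq_cfProdDen, hp, hl]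
      exact (map_cfProdDen Φ.toRingHom a a' n).symm
    have hNi (i : Fin m) : (fun n => cfProdNum a a' (fun i => (a 1 i * a' 1 i)⁻¹) n i) =
        cfProdNum (a · i) (a' · i) (a 1 i * a' 1 i)⁻¹ :=
      funext (map_cfProdNum (Pi.evalRingHom (fun _ : Fin m => ℝ) i) a a' _)
    have hDi (i : Fin m) : (fun n => cfProdDen a a' n i) = cfProdDen (a · i) (a' · i) :=
      funext (map_cfProdDen (Pi.evalRingHom (fun _ : Fin m => ℝ) i) a a')
    rw [pow_map Φ hx, ln_map Φ hx, ← map_mul]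
    refine isContFrac_map hΦ _ _ hN hD (fun i => ?_) fun i => ?_
    · rw [hNi, hDi]
      exact (hprod i).1
    · rw [hNi, hDi]
      exact (hprod i).2
  · rw [hF, isUnit_map_iff hΦ]
    intro i
    obtain ⟨k, rfl⟩ := Nat.exists_eq_add_of_le' hn
    rw [hFi]
    refine cfF_gaussCoeff_ne_zero hq0 hq1 ?_ (hz i) k
    exact div_neg_of_neg_of_pos (by linarith [hx' h i]) (by linarith [hx i])
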